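/- Let $\mathcal X$ be a real Hilbert space and let $g:\mathcal X\to\mathbb R$ be a convex differentiable function whose set of minimizers $\operatorname{argmin} g$ is nonempty. Let $t_0>0$, $\alpha,\beta,a>0$, $0<q<1$ and $q+1<p\le 2$, and assume $a\ge q(1-q)$ in the case $p=2$. Let $\delta:[t_0,+\infty)\to(0,+\infty)$ be non-decreasing and differentiable with $\lim_{t\to+\infty}\delta(t)=+\infty$, and suppose that there exists $K_1>0$ such that $t\,\dot\delta(t)<K_1\,\delta(t)$ for all sufficiently large $t$. Let $x:[t_0,+\infty)\to\mathcal X$ be a strong global solution of $$\ddot x(t)+\frac{\alpha}{t^q}\dot x(t)+\beta\nabla^2 g(x(t))\dot x(t)+\delta(t)\nabla g(x(t))+\frac{a}{t^p}x(t)=0,$$ that is, $x$ is differentiable, $\dot x$ is locally absolutely continuous, the Hessian $\nabla^2 g(x(t))$ (the Fréchet derivative of $\nabla g$ at $x(t)$) exists for every $t\ge t_0$, and the equation holds for almost every $t\ge t_0$. Then $x(t)$ converges weakly, as $t\to+\infty$, to an element of $\operatorname{argmin} g$. Moreover, for every $x^*\in\operatorname{argmin} g$, as $t\to+\infty$, $$g(x(t))-g(x^*)=o\!\left(\frac{1}{\delta(t)\,t^{2q}}\right)\quad\text{and}\quad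 \|\dot x(t)+\beta\nabla g(x(t))\|=o\!\left(\frac{1}{t^q}\right).$$ -/

import Mathlib

open Filter Topology Set MeasureTheory Asymptotics

/-- The set of (global) minimizers of `g`. -/
def argmin {X : Type*} (g : X → ℝ) : Set X := {z | ∀ y, g z ≤ g y}

/-- `f` is absolutely continuous on every compact interval `[t₀, T]`. -/
def LocallyACFrom {X : Type*} [PseudoMetricSpace X] (t₀ : ℝ) (f : ℝ → X) : Prop :=
  ∀ T, t₀ ≤ T → AbsolutelyContinuousOnInterval f t₀ T

/-- The time derivative on `[t₀, +∞)` (one-sided at `t₀`). -/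
noncomputable def timeDeriv {X : Type*} [NormedAddCommGroup X] [NormedSpace ℝ X]
    (t₀ : ℝ) (f : ℝ → X) (t : ℝ) : X := derivWithin f (Ici t₀) t

/-- `x : [t₀, +∞) → X` is a strong global solution of
`x'' + (α / t^q) x' + β ∇²g(x) x' + δ(t) ∇g(x) + (a / t^p) x = 0`:
`x` is differentiable, `x'` is locally absolutely continuous, the Hessian `∇²g` (the Fréchet
derivative of the gradient) exists along the trajectory, and the equation holds
for almost every `t ≥ t₀`. -/
structure IsStrongGlobalSolution {X : Type*} [NormedAddCommGroup X] [InnerProductSpace ℝ X]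
    [CompleteSpace X] (g : X → ℝ) (δ : ℝ → ℝ) (α β a p q t₀ : ℝ) (x : ℝ → X) : Prop where
  differentiable : DifferentiableOn ℝ x (Ici t₀)
  velocity_ac : LocallyACFrom t₀ (timeDeriv t₀ x)
  hessian_exists : ∀ t, t₀ ≤ t → DifferentiableAt ℝ (gradient g) (x t)
  equation : ∀ᵐ t ∂(volume.restrict (Ici t₀)),
    DifferentiableWithinAt ℝ (timeDeriv t₀ x) (Ici t₀) t ∧
    timeDeriv t₀ (timeDeriv t₀ x) t + (α / t ^ q) • timeDeriv t₀ x t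
      + β • fderiv ℝ (gradient g) (x t) (timeDeriv t₀ x t)
      + δ t • gradient g (x t) + (a / t ^ p) • x t = 0

/-
With `v = x' + β ∇g(x)` the second-order equation becomes a first-order system from which the
Hessian has disappeared; absolute continuity of `x'` makes it hold at every time, not only almost
everywhere.

For `z ∈ argmin g` and `0 < b < α`, the functional `𝓔_b` (`energy`) combines the mechanical energy
at the scale `t ^ (2 q)` with `b` times an anchoring term. Its derivative is at most
`-κ t ^ (-q) W + C t ^ s (1 + 𝓔_b)`, where `s < -1` and
`W = t ^ (2 q) (δ (g(x) - g(z)) + ‖v‖² / 2)`. Since `t ^ s` is integrable, `𝓔_b` converges; as `𝓔_b`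
is affine in `b`, so do its two components, and hence `W`. Since `t ^ (-q)` is not integrable, the
limit of `W` can only be `0`, which gives both rates and makes `‖x - z‖` converge. Weak convergence
is then Opial's lemma.
-/

theorem isLittleO_one_div_of_tendsto_mul {ι : Type*} {l : Filter ι} {f w : ι → ℝ}
    (hw : ∀ᶠ i in l, w i ≠ 0) (hfw : Tendsto (fun i => w i * f i) l (𝓝 0)) :
    f =o[l] fun i => 1 / w i := by
  refine (isLittleO_iff_tendsto' (hw.mono fun i hi h₀ => absurd h₀ (one_div_ne_zero hi))).2
    (hfw.congr fun i => ?_)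
  rw [div_div_eq_mul_div, div_one, mul_comm]

theorem continuousOn_div_rpow {t₀ : ℝ} (ht₀ : 0 < t₀) (c r : ℝ) :
    ContinuousOn (fun t : ℝ => c / t ^ r) (Ici t₀) :=
  continuousOn_const.div (continuousOn_id.rpow_const fun _ ht => Or.inl (ht₀.trans_le ht).ne')
    fun _ ht => (Real.rpow_pos_of_pos (ht₀.trans_le ht) r).ne'

section DifferentialInequalities

variable {E F W : ℝ → ℝ} {C L κ q s ℓ m : ℝ}

theorem tendsto_rpow_atTop_nhds_zero {r : ℝ} (hr : r < 0) :
    Tendsto (fun t : ℝ => t ^ r) atTop (𝓝 0) := by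
  simpa only [neg_neg] using tendsto_rpow_neg_atTop (neg_pos.2 hr)

theorem hasDerivAt_rpow_primitive (C : ℝ) (hs : s ≠ -1) {t : ℝ} (ht : t ≠ 0) :
    HasDerivAt (fun t : ℝ => C / (s + 1) * t ^ (s + 1)) (C * t ^ s) t := by
  have hs' : s + 1 ≠ 0 := fun h => hs (eq_neg_of_add_eq_zero_left h)
  refine ((Real.hasDerivAt_rpow_const (Or.inl ht)).const_mul (C / (s + 1))).congr_deriv ?_
  rw [add_sub_cancel_right, ← mul_assoc, div_mul_cancel₀ _ hs']

theorem exists_antitoneOn_sub_of_deriv_le (hE : ∀ᶠ t in atTop, DifferentiableAt ℝ E t)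
    (hF : ∀ᶠ t in atTop, DifferentiableAt ℝ F t) (h : ∀ᶠ t in atTop, deriv E t ≤ deriv F t) :
    ∃ T, AntitoneOn (E - F) (Ici T) := by
  obtain ⟨T, hT⟩ := eventually_atTop.1 (hE.and (hF.and h))
  have hdiff : ∀ t ∈ Ici T, DifferentiableAt ℝ (E - F) t := fun t ht =>
    (hT t ht).1.sub (hT t ht).2.1
  refine ⟨T, antitoneOn_of_deriv_nonpos (convex_Ici T)
    (fun t ht => (hdiff t ht).continuousAt.continuousWithinAt)
    (fun t ht => (hdiff t (interior_subset ht)).differentiableWithinAt) fun t ht => ?_⟩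
  obtain ⟨hEt, hFt, hle⟩ := hT t (interior_subset ht)
  rw [deriv_sub hEt hFt]
  exact sub_nonpos.2 hle

theorem exists_tendsto_of_deriv_le (hE : ∀ᶠ t in atTop, DifferentiableAt ℝ E t)
    (hF : ∀ᶠ t in atTop, DifferentiableAt ℝ F t) (h : ∀ᶠ t in atTop, deriv E t ≤ deriv F t)
    (hFlim : Tendsto F atTop (𝓝 ℓ)) (hbdd : ∀ᶠ t in atTop, m ≤ E t) :
    ∃ L, Tendsto E atTop (𝓝 L) := by
  obtain ⟨T₁, hanti⟩ := exists_antitoneOn_sub_of_deriv_le hE hF h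
  have hlow : ∀ᶠ t in atTop, m - (ℓ + 1) ≤ (E - F) t := by
    filter_upwards [hbdd, hFlim.eventually_lt_const (lt_add_one ℓ)] with t hEt hFt
    exact sub_le_sub hEt hFt.le
  obtain ⟨T₂, hT₂⟩ := eventually_atTop.1 hlow
  set T := max T₁ T₂
  have hmax : Antitone fun t => (E - F) (max T t) := fun s t hst =>
    hanti ((le_max_left T₁ T₂).trans (le_max_left T s))
      ((le_max_left T₁ T₂).trans (le_max_left T t)) (max_le_max_left T hst)
  have hbelow : BddBelow (range fun t => (E - F) (max T t)) := by
    refine ⟨m - (ℓ + 1), ?_⟩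
    rintro _ ⟨t, rfl⟩
    exact hT₂ _ ((le_max_right T₁ T₂).trans (le_max_left T t))
  refine ⟨_, ((tendsto_atTop_ciInf hmax hbelow).add hFlim).congr' ?_⟩
  filter_upwards [eventually_ge_atTop T] with t ht
  rw [max_eq_right ht, Pi.sub_apply, sub_add_cancel]

theorem tendsto_atBot_of_deriv_le (hE : ∀ᶠ t in atTop, DifferentiableAt ℝ E t)
    (hF : ∀ᶠ t in atTop, DifferentiableAt ℝ F t) (h : ∀ᶠ t in atTop, deriv E t ≤ deriv F t)
    (hFlim : Tendsto F atTop atBot) : Tendsto E atTop atBot := by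
  obtain ⟨T, hanti⟩ := exists_antitoneOn_sub_of_deriv_le hE hF h
  refine tendsto_atBot_mono' _ ?_ (tendsto_atBot_add_const_left _ ((E - F) T) hFlim)
  filter_upwards [eventually_ge_atTop T] with t ht
  exact sub_le_iff_le_add.1 (hanti self_mem_Ici ht ht)

theorem exists_tendsto_of_deriv_le_rpow (hs : s < -1)
    (hE : ∀ᶠ t in atTop, DifferentiableAt ℝ E t) (h : ∀ᶠ t in atTop, deriv E t ≤ C * t ^ s)
    (hbdd : ∀ᶠ t in atTop, m ≤ E t) : ∃ L, Tendsto E atTop (𝓝 L) := by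
  have hF : ∀ᶠ t : ℝ in atTop,
      HasDerivAt (fun t : ℝ => C / (s + 1) * t ^ (s + 1)) (C * t ^ s) t := by
    filter_upwards [eventually_ne_atTop 0] with t ht using hasDerivAt_rpow_primitive C hs.ne ht
  refine exists_tendsto_of_deriv_le hE (hF.mono fun t ht => ht.differentiableAt) ?_
    ((tendsto_rpow_atTop_nhds_zero (by linarith)).const_mul (C / (s + 1))) hbdd
  filter_upwards [h, hF] with t hle ht
  rwa [ht.deriv]

theorem exists_tendsto_of_deriv_le_rpow_mul_one_add (hs : s < -1)
    (hE : ∀ᶠ t in atTop, DifferentiableAt ℝ E t)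
    (h : ∀ᶠ t in atTop, deriv E t ≤ C * t ^ s * (1 + E t)) (hE₀ : ∀ᶠ t in atTop, 0 ≤ E t) :
    ∃ L, Tendsto E atTop (𝓝 L) := by
  have hlog : ∀ᶠ t in atTop,
      HasDerivAt (fun t => Real.log (1 + E t)) (deriv E t / (1 + E t)) t := by
    filter_upwards [hE, hE₀] with t ht hnonneg
    exact (ht.hasDerivAt.const_add 1).log (by positivity)
  obtain ⟨L, hL⟩ : ∃ L, Tendsto (fun t => Real.log (1 + E t)) atTop (𝓝 L) := by
    refine exists_tendsto_of_deriv_le_rpow (C := C) (m := 0) hs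
      (hlog.mono fun t ht => ht.differentiableAt) ?_
      (hE₀.mono fun t ht => Real.log_nonneg (by linarith))
    filter_upwards [hlog, h, hE₀] with t ht hle hnonneg
    rw [ht.deriv]
    exact (div_le_iff₀ (by positivity)).2 hle
  refine ⟨Real.exp L - 1, (hL.rexp.sub_const 1).congr' ?_⟩
  filter_upwards [hE₀] with t ht
  rw [Real.exp_log (by positivity), add_sub_cancel_left]

-- Were the limit of `W` positive, the non-integrable `t ^ (-q)` would drive `E` to `-∞`.
theorem limit_nonpos_of_deriv_le (hκ : 0 < κ) (hq : q < 1) (hs : s < -1)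
    (hE : ∀ᶠ t in atTop, DifferentiableAt ℝ E t)
    (h : ∀ᶠ t in atTop, deriv E t ≤ -(κ * W t * t ^ (-q)) + C * t ^ s * (1 + E t))
    (hElim : Tendsto E atTop (𝓝 ℓ)) (hWlim : Tendsto W atTop (𝓝 L)) : L ≤ 0 := by
  by_contra! hL
  set c := κ * L / 2
  have hrate : Tendsto (fun t => -(κ * W t) + C * t ^ (s + q) * (1 + E t)) atTop
      (𝓝 (-(κ * L) + C * 0 * (1 + ℓ))) :=
    (hWlim.const_mul κ).neg.add (((tendsto_rpow_atTop_nhds_zero (by linarith)).const_mul C).mul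
      (hElim.const_add 1))
  have hneg : -(κ * L) + C * 0 * (1 + ℓ) < -c := by
    rw [mul_zero, zero_mul, add_zero]
    exact neg_lt_neg (half_lt_self (mul_pos hκ hL))
  have hF : ∀ᶠ t : ℝ in atTop,
      HasDerivAt (fun t : ℝ => -c / (-q + 1) * t ^ (-q + 1)) (-c * t ^ (-q)) t := by
    filter_upwards [eventually_ne_atTop 0] with t ht
    exact hasDerivAt_rpow_primitive (-c) (by linarith) ht
  have hFlim : Tendsto (fun t : ℝ => -c / (-q + 1) * t ^ (-q + 1)) atTop atBot :=
    (tendsto_rpow_atTop (by linarith)).const_mul_atTop_of_neg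
      (div_neg_of_neg_of_pos (neg_neg_of_pos (half_pos (mul_pos hκ hL))) (by linarith))
  refine not_tendsto_nhds_of_tendsto_atBot (tendsto_atBot_of_deriv_le hE
    (hF.mono fun t ht => ht.differentiableAt) ?_ hFlim) ℓ hElim
  filter_upwards [h, hF, hrate.eventually_lt_const hneg, eventually_gt_atTop 0]
    with t hle ht hlt hpos
  rw [ht.deriv]
  calc deriv E t ≤ (-(κ * W t) + C * t ^ (s + q) * (1 + E t)) * t ^ (-q) := by
        refine hle.trans_eq ?_
        rw [← add_neg_cancel_right s q, Real.rpow_add hpos, add_neg_cancel_right]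
        ring
    _ ≤ -c * t ^ (-q) := by gcongr

end DifferentialInequalities

section InnerProduct

variable {H : Type*} [NormedAddCommGroup H] [InnerProductSpace ℝ H]

theorem neg_inner_sub_le_norm_sq (y z : H) : -inner ℝ (y - z) y ≤ ‖z‖ ^ 2 / 2 := by
  have hexpand := norm_sub_sq_real y z
  rw [inner_sub_left, real_inner_self_eq_norm_sq, real_inner_comm]
  linarith [sq_nonneg ‖y - z‖, sq_nonneg ‖y‖]

theorem neg_mul_inner_le_of_inner_sub_nonneg {u y z : H} {r s : ℝ} (hr : 0 ≤ r) (hs : 0 ≤ s)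
    (hu : 0 ≤ inner ℝ u (y - z)) :
    -(2 * (r * s) * inner ℝ u y) ≤ r ^ 2 * ‖u‖ ^ 2 + s ^ 2 * ‖z‖ ^ 2 := by
  have hinner : -inner ℝ u y ≤ ‖u‖ * ‖z‖ := by
    have hcs := neg_le_of_abs_le (abs_real_inner_le_norm u z)
    rw [inner_sub_right] at hu
    linarith
  linarith [mul_le_mul_of_nonneg_left hinner (mul_nonneg hr hs),
    sq_nonneg (r * ‖u‖ - s * ‖z‖)]

theorem inner_gradient_le_sub_of_convexOn [CompleteSpace H] {g : H → ℝ}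
    (hg : ConvexOn ℝ univ g) {x : H} (hd : DifferentiableAt ℝ g x) (y : H) :
    inner ℝ (gradient g x) (y - x) ≤ g y - g x := by
  have hline : ConvexOn ℝ univ (fun s : ℝ => g (AffineMap.lineMap x y s)) := by
    simpa only [preimage_univ, Function.comp_def] using!
      hg.comp_affineMap (AffineMap.lineMap x y : ℝ →ᵃ[ℝ] H)
  have hderiv : HasDerivAt (fun s : ℝ => g (AffineMap.lineMap x y s))
      (inner ℝ (gradient g x) (y - x)) 0 := by
    have hgx : HasFDerivAt g (fderiv ℝ g x) (AffineMap.lineMap x y (0 : ℝ)) := by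
      simpa only [AffineMap.lineMap_apply_zero] using hd.hasFDerivAt
    simpa only [inner_gradient_left] using!
      hgx.comp_hasDerivAt (0 : ℝ) AffineMap.hasDerivAt_lineMap
  have hslope := hline.le_slope_of_hasDerivAt (mem_univ 0) (mem_univ 1) zero_lt_one hderiv
  simpa only [slope, AffineMap.lineMap_apply_one, AffineMap.lineMap_apply_zero, sub_zero, inv_one,
    one_smul, vsub_eq_sub] using hslope

end InnerProduct

theorem le_of_mapClusterPt_toWeakSpace {ι E : Type*} [NormedAddCommGroup E] [NormedSpace ℝ E]
    {g : E → ℝ} (hg : ConvexOn ℝ univ g) (hlsc : LowerSemicontinuous g) {l : Filter ι} {x : ι → E}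
    {w : E} {m : ℝ} (hgx : Tendsto (fun i => g (x i)) l (𝓝 m))
    (hw : MapClusterPt (toWeakSpace ℝ E w) l fun i => toWeakSpace ℝ E (x i)) : g w ≤ m := by
  refine le_of_forall_gt_imp_ge_of_dense fun c hc => ?_
  have hclosed : IsClosed {y | g y ≤ c} := hlsc.isClosed_preimage c
  have hconvex : Convex ℝ {y | g y ≤ c} := by
    simpa only [mem_univ, true_and] using hg.convex_le c
  have hweak : IsClosed (toWeakSpace ℝ E '' {y | g y ≤ c}) := by
    rw [← hclosed.closure_eq, hconvex.toWeakSpace_closure ℝ]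
    exact isClosed_closure
  have hmem : ∀ᶠ i in l, toWeakSpace ℝ E (x i) ∈ toWeakSpace ℝ E '' {y | g y ≤ c} :=
    (hgx.eventually_le_const hc).mono fun i hi => mem_image_of_mem _ hi
  obtain ⟨y, hy, hyw⟩ := hweak.mem_of_mapClusterPt hw hmem
  rwa [← (toWeakSpace ℝ E).injective hyw]

section WeakConvergence

variable {ι X : Type*} [NormedAddCommGroup X] [InnerProductSpace ℝ X]

theorem isCompact_toWeakSpace_closedBall [CompleteSpace X] (r : ℝ) :
    IsCompact (toWeakSpace ℝ X '' Metric.closedBall 0 r) := by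
  set f : WeakDual ℝ X → WeakSpace ℝ X := fun φ =>
    toWeakSpace ℝ X ((InnerProductSpace.toDual ℝ X).symm (WeakDual.toStrongDual φ)) with hf
  have hcont : Continuous f := by
    refine WeakBilin.continuous_of_continuous_eval _ fun L => ?_
    refine (WeakDual.eval_continuous (𝕜 := ℝ) ((InnerProductSpace.toDual ℝ X).symm L)).congr
      fun φ => ?_
    calc φ ((InnerProductSpace.toDual ℝ X).symm L)
        = inner ℝ ((InnerProductSpace.toDual ℝ X).symm (WeakDual.toStrongDual φ))
            ((InnerProductSpace.toDual ℝ X).symm L) :=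
          (InnerProductSpace.toDual_symm_apply (𝕜 := ℝ)).symm
      _ = L ((InnerProductSpace.toDual ℝ X).symm (WeakDual.toStrongDual φ)) := by
          rw [real_inner_comm, InnerProductSpace.toDual_symm_apply]
  have himage : toWeakSpace ℝ X '' Metric.closedBall 0 r =
      f '' (WeakDual.toStrongDual ⁻¹' Metric.closedBall 0 r) := by
    ext y
    constructor
    · rintro ⟨x, hx, rfl⟩
      refine ⟨StrongDual.toWeakDual (InnerProductSpace.toDual ℝ X x), ?_, ?_⟩
      · simpa using hx
      · simp [hf]
    · rintro ⟨φ, hφ, rfl⟩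
      exact ⟨_, by simpa using hφ, rfl⟩
  rw [himage]
  exact (WeakDual.isCompact_closedBall (𝕜 := ℝ) 0 r).image hcont

theorem eq_of_mapClusterPt_toWeakSpace {l : Filter ι} {x : ι → X} {y z : X} {r s : ℝ}
    (hy : Tendsto (fun i => ‖x i - y‖) l (𝓝 r)) (hz : Tendsto (fun i => ‖x i - z‖) l (𝓝 s))
    (hy' : MapClusterPt (toWeakSpace ℝ X y) l fun i => toWeakSpace ℝ X (x i))
    (hz' : MapClusterPt (toWeakSpace ℝ X z) l fun i => toWeakSpace ℝ X (x i)) : y = z := by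
  have hlim : Tendsto (fun i => inner ℝ (y - z) (x i)) l
      (𝓝 ((s ^ 2 - r ^ 2 + ‖y‖ ^ 2 - ‖z‖ ^ 2) / 2)) := by
    refine (((((hz.pow 2).sub (hy.pow 2)).add_const (‖y‖ ^ 2)).sub_const (‖z‖ ^ 2)).div_const
      2).congr fun i => ?_
    rw [norm_sub_sq_real, norm_sub_sq_real, inner_sub_left, real_inner_comm y, real_inner_comm z]
    ring
  have hinner : ∀ w, MapClusterPt (toWeakSpace ℝ X w) l (fun i => toWeakSpace ℝ X (x i)) →
      inner ℝ (y - z) w = (s ^ 2 - r ^ 2 + ‖y‖ ^ 2 - ‖z‖ ^ 2) / 2 := fun w hw => by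
    have heval : Continuous fun u : WeakSpace ℝ X => innerSL ℝ (y - z) ((toWeakSpace ℝ X).symm u) :=
      WeakBilin.eval_continuous (topDualPairing ℝ X).flip (innerSL ℝ (y - z))
    have hcluster := hw.continuousAt_comp heval.continuousAt
    exact eq_of_nhds_neBot (NeBot.mono hcluster (inf_le_inf_left _ hlim))
  rw [← sub_eq_zero, ← inner_self_eq_zero (𝕜 := ℝ), inner_sub_right, hinner y hy', hinner z hz',
    sub_self]

theorem exists_tendsto_toWeakSpace_of_opial [CompleteSpace X] {l : Filter ι} [NeBot l] {x : ι → X}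
    {S : Set X} (hS : S.Nonempty) (hdist : ∀ z ∈ S, ∃ r, Tendsto (fun i => ‖x i - z‖) l (𝓝 r))
    (hcluster : ∀ w, MapClusterPt (toWeakSpace ℝ X w) l (fun i => toWeakSpace ℝ X (x i)) → w ∈ S) :
    ∃ z ∈ S, Tendsto (fun i => toWeakSpace ℝ X (x i)) l (𝓝 (toWeakSpace ℝ X z)) := by
  obtain ⟨z₀, hz₀⟩ := hS
  obtain ⟨r, hr⟩ := hdist z₀ hz₀
  have hball : ∀ᶠ i in l, toWeakSpace ℝ X (x i) ∈
      toWeakSpace ℝ X '' Metric.closedBall 0 (r + 1 + ‖z₀‖) := by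
    filter_upwards [hr.eventually_le_const (lt_add_one r)] with i hi
    refine mem_image_of_mem _ (mem_closedBall_zero_iff.2 ?_)
    calc ‖x i‖ = ‖x i - z₀ + z₀‖ := by rw [sub_add_cancel]
      _ ≤ ‖x i - z₀‖ + ‖z₀‖ := norm_add_le _ _
      _ ≤ r + 1 + ‖z₀‖ := by gcongr
  have hcompact := isCompact_toWeakSpace_closedBall (X := X) (r + 1 + ‖z₀‖)
  obtain ⟨-, ⟨z, -, rfl⟩, hz⟩ := hcompact.exists_mapClusterPt (le_principal_iff.2 hball)
  obtain ⟨s, hs⟩ := hdist z (hcluster z hz)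
  refine ⟨z, hcluster z hz, hcompact.tendsto_nhds_of_unique_mapClusterPt hball ?_⟩
  rintro - ⟨w, -, rfl⟩ hw
  obtain ⟨s', hs'⟩ := hdist w (hcluster w hw)
  rw [eq_of_mapClusterPt_toWeakSpace hs' hs hw hz]

end WeakConvergence

section AbsoluteContinuity

theorem absolutelyContinuousOnInterval_lipschitz_comp {X Y : Type*} [PseudoMetricSpace X]
    [PseudoMetricSpace Y] {f : ℝ → X} {a b : ℝ} (hf : AbsolutelyContinuousOnInterval f a b)
    {φ : X → Y} {K : NNReal} (hφ : LipschitzWith K φ) :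
    AbsolutelyContinuousOnInterval (φ ∘ f) a b := by
  refine squeeze_zero (fun E => Finset.sum_nonneg fun i _ => dist_nonneg) (fun E => ?_)
    (by simpa only [mul_zero] using Tendsto.const_mul (K : ℝ) hf)
  rw [Finset.mul_sum]
  exact Finset.sum_le_sum fun i _ => hφ.dist_le_mul _ _

theorem LocallyACFrom.continuousOn {X : Type*} [SeminormedAddCommGroup X] {f : ℝ → X} {t₀ : ℝ}
    (hf : LocallyACFrom t₀ f) : ContinuousOn f (Ici t₀) := by
  intro t ht
  have hle : t₀ ≤ t + 1 := (mem_Ici.1 ht).trans (lt_add_one t).le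
  have hcont := (hf (t + 1) hle).continuousOn
  rw [uIcc_of_le hle] at hcont
  refine (hcont t ⟨ht, (lt_add_one t).le⟩).mono_of_mem_nhdsWithin ?_
  rw [← Ici_inter_Iic]
  exact inter_mem_nhdsWithin _ (Iic_mem_nhds (lt_add_one t))

-- `h` need not be absolutely continuous: `h' = F - f'` is integrable because `F` and `f'` are.
theorem integral_eq_sub_of_ae_hasDerivAt_add_real {f h F : ℝ → ℝ} {s T : ℝ} (hsT : s ≤ T)
    (hf : AbsolutelyContinuousOnInterval f s T) (hh : ContinuousOn h (Icc s T))
    (hh' : ∀ t ∈ Ioo s T, DifferentiableAt ℝ h t) (hF : ContinuousOn F (Icc s T))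
    (hfh : ∀ᵐ t, t ∈ Ioo s T → HasDerivAt (f + h) (F t) t) :
    ∫ t in s..T, F t = (f + h) T - (f + h) s := by
  have hF_int : IntervalIntegrable F volume s T := hF.intervalIntegrable_of_Icc hsT
  have hf_int : IntervalIntegrable (deriv f) volume s T := hf.intervalIntegrable_deriv
  have hae : ∀ᵐ t, t ∈ uIoc s T → F t - deriv f t = deriv h t := by
    filter_upwards [hfh, measure_eq_zero_iff_ae_notMem.1 (Real.volume_singleton (a := T))]
      with t ht htT hmem
    rw [uIoc_of_le hsT] at hmem
    have hmem' : t ∈ Ioo s T := ⟨hmem.1, hmem.2.lt_of_ne htT⟩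
    have hsub := (ht hmem').sub (hh' t hmem').hasDerivAt
    rw [add_sub_cancel_right] at hsub
    rw [hsub.deriv, sub_sub_cancel]
  have hh_int : IntervalIntegrable (deriv h) volume s T :=
    (hF_int.sub hf_int).congr_ae ((ae_restrict_iff' measurableSet_uIoc).2 hae)
  have hh_ftc : ∫ t in s..T, deriv h t = h T - h s :=
    intervalIntegral.integral_eq_sub_of_hasDerivAt_of_le hsT hh
      (fun t ht => (hh' t ht).hasDerivAt) hh_int
  have hsplit : ∫ t in s..T, F t - deriv f t = h T - h s :=
    (intervalIntegral.integral_congr_ae hae).trans hh_ftc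
  rw [intervalIntegral.integral_sub hF_int hf_int, hf.integral_deriv_eq_sub] at hsplit
  simp only [Pi.add_apply]
  linarith

variable {E : Type*} [NormedAddCommGroup E] [NormedSpace ℝ E] {f h F : ℝ → E} {s t t₀ T : ℝ}

theorem integral_eq_sub_of_ae_hasDerivAt_add [CompleteSpace E] (hsT : s ≤ T)
    (hf : AbsolutelyContinuousOnInterval f s T) (hh : ContinuousOn h (Icc s T))
    (hh' : ∀ t ∈ Ioo s T, DifferentiableAt ℝ h t) (hF : ContinuousOn F (Icc s T))
    (hfh : ∀ᵐ t, t ∈ Ioo s T → HasDerivAt (f + h) (F t) t) :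
    ∫ t in s..T, F t = (f + h) T - (f + h) s := by
  refine (SeparatingDual.eq_iff_forall_dual_eq (R := ℝ)).2 fun L => ?_
  have hL : L ∘ (f + h) = L ∘ f + L ∘ h := by
    ext t
    exact map_add L (f t) (h t)
  have hreal := integral_eq_sub_of_ae_hasDerivAt_add_real hsT
    (absolutelyContinuousOnInterval_lipschitz_comp hf L.lipschitz)
    (L.continuous.comp_continuousOn hh)
    (fun t ht => L.differentiableAt.comp t (hh' t ht)) (L.continuous.comp_continuousOn hF)
    (hfh.mono fun t ht hmem => hL ▸ L.hasFDerivAt.comp_hasDerivAt t (ht hmem))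
  rw [← hL] at hreal
  rw [← L.intervalIntegral_comp_comm (hF.intervalIntegrable_of_Icc hsT), map_sub]
  exact hreal

theorem LocallyACFrom.hasDerivAt_add [CompleteSpace E] (hf : LocallyACFrom t₀ f)
    (hh : ContinuousOn h (Ici t₀)) (hh' : ∀ t, t₀ < t → DifferentiableAt ℝ h t)
    (hF : ContinuousOn F (Ici t₀)) (hfh : ∀ᵐ t, t₀ < t → HasDerivAt (f + h) (F t) t)
    (ht : t₀ < t) : HasDerivAt (f + h) (F t) t := by
  have hftc : ∀ T, t₀ ≤ T → (f + h) T = (f + h) t₀ + ∫ s in t₀..T, F s := fun T hT => by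
    rw [integral_eq_sub_of_ae_hasDerivAt_add hT (hf T hT) (hh.mono Icc_subset_Ici_self)
      (fun s hs => hh' s hs.1) (hF.mono Icc_subset_Ici_self)
      (hfh.mono fun s hs hmem => hs hmem.1), add_sub_cancel]
  have hderiv : HasDerivAt (fun T => (f + h) t₀ + ∫ s in t₀..T, F s) (F t) t :=
    (intervalIntegral.integral_hasDerivAt_right
      ((hF.mono Icc_subset_Ici_self).intervalIntegrable_of_Icc ht.le)
      ((hF.mono Ioi_subset_Ici_self).stronglyMeasurableAtFilter isOpen_Ioi t ht)
      (hF.continuousAt (Ici_mem_nhds ht))).const_add _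
  refine hderiv.congr_of_eventuallyEq ?_
  filter_upwards [Ioi_mem_nhds ht] with T hT using hftc T (le_of_lt hT)

theorem hasDerivAt_timeDeriv (hf : DifferentiableWithinAt ℝ f (Ici t₀) t) (ht : t₀ < t) :
    HasDerivAt f (timeDeriv t₀ f t) t :=
  hf.hasDerivWithinAt.hasDerivAt (Ici_mem_nhds ht)

end AbsoluteContinuity

section Energy

variable {X : Type*} [NormedAddCommGroup X] {g : X → ℝ} {δ : ℝ → ℝ} {α β a b p q t : ℝ}
  {x v : ℝ → X} {z : X}

/-- The mechanical energy of a trajectory relative to `z`; the argument `v` here and below stands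
for `x' + β ∇g(x)` rather than for the velocity. -/
noncomputable def mechanicalEnergy (g : X → ℝ) (δ : ℝ → ℝ) (z : X) (x v : ℝ → X) (t : ℝ) : ℝ :=
  δ t * (g (x t) - g z) + 1 / 2 * ‖v t‖ ^ 2

theorem mechanicalEnergy_nonneg (hδ : 0 ≤ δ t) (hz : z ∈ argmin g) :
    0 ≤ mechanicalEnergy g δ z x v t :=
  add_nonneg (mul_nonneg hδ (sub_nonneg.2 (hz _))) (by positivity)

theorem rpow_mul_mechanicalEnergy_mul_rpow_neg (ht : 0 < t) :
    t ^ (2 * q) * mechanicalEnergy g δ z x v t * t ^ (-q) =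
      t ^ q * δ t * (g (x t) - g z) + 1 / 2 * (t ^ q * ‖v t‖ ^ 2) := by
  have hpow : t ^ q = t ^ (2 * q) * t ^ (-q) := by
    rw [← Real.rpow_add ht]
    ring_nf
  rw [hpow, mechanicalEnergy]
  ring

variable [InnerProductSpace ℝ X]

/-- The mechanical energy at the time scale `t ^ (2 * q)`, corrected by the potentials that cancel
the contributions of the Hessian damping and of the Tikhonov term to its derivative. -/
noncomputable def tikhonovEnergy (g : X → ℝ) (δ : ℝ → ℝ) (α β a p q : ℝ) (z : X) (x v : ℝ → X)
    (t : ℝ) : ℝ :=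
  t ^ (2 * q) * mechanicalEnergy g δ z x v t - α * β * t ^ q * (g (x t) - g z)
    + a / 2 * t ^ (2 * q - p) * ‖x t‖ ^ 2

/-- The anchoring functional, which pulls the trajectory towards `z`: the pairing of `x - z` with
`t ^ q • v`, corrected so that its derivative contains no such pairing. -/
noncomputable def anchor (g : X → ℝ) (α β q : ℝ) (z : X) (x v : ℝ → X) (t : ℝ) : ℝ :=
  β * t ^ q * (g (x t) - g z) + t ^ q * inner ℝ (x t - z) (v t)
    + 1 / 2 * (α - q * t ^ (q - 1)) * ‖x t - z‖ ^ 2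

/-- The Lyapunov functional `𝓔_b` of the system; it is affine in the anchoring weight `b`. -/
noncomputable def energy (g : X → ℝ) (δ : ℝ → ℝ) (α β a p q b : ℝ) (z : X) (x v : ℝ → X)
    (t : ℝ) : ℝ :=
  tikhonovEnergy g δ α β a p q z x v t + b * anchor g α β q z x v t

theorem rpow_two_mul (ht : 0 < t) (q : ℝ) : t ^ (2 * q) = (t ^ q) ^ 2 := by
  rw [two_mul, Real.rpow_add ht, sq]

theorem energy_eq_add_norm_sq (ht : 0 < t) :
    energy g δ α β a p q b z x v t =
      (t ^ (2 * q) * δ t - (α - b) * β * t ^ q) * (g (x t) - g z)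
        + 1 / 2 * ‖b • (x t - z) + t ^ q • v t‖ ^ 2
        + 1 / 2 * (b * (α - b - q * t ^ (q - 1))) * ‖x t - z‖ ^ 2
        + a / 2 * t ^ (2 * q - p) * ‖x t‖ ^ 2 := by
  simp only [energy, tikhonovEnergy, anchor, mechanicalEnergy, norm_add_sq_real,
    real_inner_smul_left, real_inner_smul_right, norm_smul, mul_pow, Real.norm_eq_abs, sq_abs,
    rpow_two_mul ht]
  ring

theorem le_energy (ha : 0 ≤ a) (hb : 0 ≤ b) (ht : 0 < t) (hz : z ∈ argmin g)
    (hδ : 2 * ((α - b) * β) ≤ t ^ q * δ t) (hq : q * t ^ (q - 1) ≤ (α - b) / 2) :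
    1 / 2 * (t ^ (2 * q) * δ t * (g (x t) - g z)) + b * (α - b) / 4 * ‖x t - z‖ ^ 2 ≤
      energy g δ α β a p q b z x v t := by
  have hgap : 0 ≤ g (x t) - g z := sub_nonneg.2 (hz _)
  have hpotential : 1 / 2 * (t ^ (2 * q) * δ t) * (g (x t) - g z) ≤
      (t ^ (2 * q) * δ t - (α - b) * β * t ^ q) * (g (x t) - g z) := by
    refine mul_le_mul_of_nonneg_right ?_ hgap
    rw [rpow_two_mul ht]
    linarith [mul_le_mul_of_nonneg_left hδ (Real.rpow_nonneg ht.le q)]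
  have hdist : b * (α - b) / 4 * ‖x t - z‖ ^ 2 ≤
      1 / 2 * (b * (α - b - q * t ^ (q - 1))) * ‖x t - z‖ ^ 2 := by
    refine mul_le_mul_of_nonneg_right ?_ (by positivity)
    linarith [mul_le_mul_of_nonneg_left hq hb]
  have hsquare : 0 ≤ 1 / 2 * ‖b • (x t - z) + t ^ q • v t‖ ^ 2 := by positivity
  have htikhonov : 0 ≤ a / 2 * t ^ (2 * q - p) * ‖x t‖ ^ 2 := by positivity
  rw [energy_eq_add_norm_sq ht]
  linarith

variable [CompleteSpace X]

/-- The second-order equation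
`x'' + (α / t ^ q) x' + β ∇²g(x) x' + δ(t) ∇g(x) + (a / t ^ p) x = 0` at time `t`, as a
first-order system in `x` and `v = x' + β ∇g(x)`, in which the Hessian no longer appears. -/
structure IsFirstOrderSolutionAt (g : X → ℝ) (δ : ℝ → ℝ) (α β a p q : ℝ) (x v : ℝ → X)
    (t : ℝ) : Prop where
  position : HasDerivAt x (v t - β • gradient g (x t)) t
  momentum : HasDerivAt v (-((α / t ^ q) • (v t - β • gradient g (x t)))
    - δ t • gradient g (x t) - (a / t ^ p) • x t) t

theorem IsFirstOrderSolutionAt.hasDerivAt_gap (h : IsFirstOrderSolutionAt g δ α β a p q x v t)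
    (hg : DifferentiableAt ℝ g (x t)) (z : X) :
    HasDerivAt (fun s => g (x s) - g z)
      (inner ℝ (gradient g (x t)) (v t - β • gradient g (x t))) t := by
  simpa only [inner_gradient_left] using!
    (hg.hasFDerivAt.comp_hasDerivAt t h.position).sub_const (g z)

theorem IsFirstOrderSolutionAt.hasDerivAt_tikhonovEnergy
    (h : IsFirstOrderSolutionAt g δ α β a p q x v t) (ht : 0 < t)
    (hg : DifferentiableAt ℝ g (x t)) (hδ : DifferentiableAt ℝ δ t) (z : X) :
    HasDerivAt (tikhonovEnergy g δ α β a p q z x v)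
      ((2 * q * t ^ (2 * q - 1) * δ t + t ^ (2 * q) * deriv δ t - α * β * (q * t ^ (q - 1)))
          * (g (x t) - g z)
        - β * t ^ q * (t ^ q * δ t - α * β) * ‖gradient g (x t)‖ ^ 2
        - t ^ q * (α - q * t ^ (q - 1)) * ‖v t‖ ^ 2
        - a / 2 * (p - 2 * q) * t ^ (2 * q - p - 1) * ‖x t‖ ^ 2
        - a * β * t ^ (2 * q - p) * inner ℝ (gradient g (x t)) (x t)) t := by
  have hpow : ∀ r : ℝ, HasDerivAt (fun s : ℝ => s ^ r) (r * t ^ (r - 1)) t := fun r =>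
    Real.hasDerivAt_rpow_const (Or.inl ht.ne')
  have hgap := h.hasDerivAt_gap hg z
  have hmechanical := (hpow (2 * q)).mul
    ((hδ.hasDerivAt.mul hgap).add (h.momentum.norm_sq.const_mul (1 / 2 : ℝ)))
  have hpotential := ((hpow q).const_mul (α * β)).mul hgap
  have htikhonov := ((hpow (2 * q - p)).const_mul (a / 2)).mul h.position.norm_sq
  have hQ : t ^ q ≠ 0 := (Real.rpow_pos_of_pos ht q).ne'
  have hP : t ^ p ≠ 0 := (Real.rpow_pos_of_pos ht p).ne'
  have hQI : t ^ (2 * q - 1) = t ^ q * t ^ (q - 1) := by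
    rw [← Real.rpow_add ht]
    ring_nf
  refine ((hmechanical.sub hpotential).add htikhonov).congr_deriv ?_
  simp only [Pi.mul_apply, Pi.add_apply, inner_sub_right, inner_neg_right,
    real_inner_smul_right, real_inner_self_eq_norm_sq, real_inner_comm (v t) (gradient g (x t)),
    real_inner_comm (x t) (gradient g (x t)), real_inner_comm (x t) (v t), hQI,
    Real.rpow_sub ht (2 * q) p, rpow_two_mul ht]
  field_simp
  ring

theorem IsFirstOrderSolutionAt.hasDerivAt_anchor
    (h : IsFirstOrderSolutionAt g δ α β a p q x v t) (ht : 0 < t)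
    (hg : DifferentiableAt ℝ g (x t)) (z : X) :
    HasDerivAt (anchor g α β q z x v)
      (β * (q * t ^ (q - 1)) * (g (x t) - g z) - β ^ 2 * t ^ q * ‖gradient g (x t)‖ ^ 2
        + t ^ q * ‖v t‖ ^ 2
        - (t ^ q * δ t - β * (q * t ^ (q - 1))) * inner ℝ (gradient g (x t)) (x t - z)
        - a * t ^ (q - p) * inner ℝ (x t - z) (x t)
        + 1 / 2 * (q * (1 - q)) * t ^ (q - 2) * ‖x t - z‖ ^ 2) t := by
  have hpow : ∀ r : ℝ, HasDerivAt (fun s : ℝ => s ^ r) (r * t ^ (r - 1)) t := fun r =>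
    Real.hasDerivAt_rpow_const (Or.inl ht.ne')
  have hdiff : HasDerivAt (fun s => x s - z) (v t - β • gradient g (x t)) t :=
    h.position.sub_const z
  have hpotential := ((hpow q).const_mul β).mul (h.hasDerivAt_gap hg z)
  have hpairing := (hpow q).mul (hdiff.inner ℝ h.momentum)
  have hdist := ((((hpow (q - 1)).const_mul q).const_sub α).const_mul (1 / 2 : ℝ)).mul
    hdiff.norm_sq
  have hQ : t ^ q ≠ 0 := (Real.rpow_pos_of_pos ht q).ne'
  have hP : t ^ p ≠ 0 := (Real.rpow_pos_of_pos ht p).ne'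
  have hexp : q - 1 - 1 = q - 2 := by ring
  refine ((hpotential.add hpairing).add hdist).congr_deriv ?_
  generalize x t - z = w
  simp only [inner_sub_right, inner_sub_left, inner_neg_right, real_inner_smul_left,
    real_inner_smul_right, real_inner_self_eq_norm_sq, real_inner_comm w (gradient g (x t)),
    real_inner_comm (v t) (gradient g (x t)), hexp, Real.rpow_sub ht q p]
  field_simp
  ring

end Energy

section Dissipation

variable {X : Type*} [NormedAddCommGroup X] [InnerProductSpace ℝ X] [CompleteSpace X]
  {g : X → ℝ} {δ : ℝ → ℝ} {α β a b p q t ε : ℝ} {x v : ℝ → X} {z : X}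

/-- A trajectory which from some time on solves the first-order system, for a convex differentiable
potential and parameters and a time scaling `δ` in the range of the convergence analysis. -/
structure IsDampedTrajectory (g : X → ℝ) (δ : ℝ → ℝ) (α β a p q : ℝ) (x v : ℝ → X) : Prop where
  convexOn : ConvexOn ℝ univ g
  differentiable : Differentiable ℝ g
  α_pos : 0 < α
  β_nonneg : 0 ≤ β
  a_nonneg : 0 ≤ a
  q_nonneg : 0 ≤ q
  q_lt_one : q < 1
  q_add_one_lt : q + 1 < p
  tendsto_δ : Tendsto δ atTop atTop
  differentiableAt_δ : ∀ᶠ t in atTop, DifferentiableAt ℝ δ t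
  growth : ∃ K, ∀ᶠ t in atTop, t * deriv δ t ≤ K * δ t
  solution : ∀ᶠ t in atTop, IsFirstOrderSolutionAt g δ α β a p q x v t

namespace IsDampedTrajectory

theorem tendsto_rpow_mul_δ (h : IsDampedTrajectory g δ α β a p q x v) :
    Tendsto (fun t => t ^ q * δ t) atTop atTop := by
  refine tendsto_atTop_mono' _ ?_ h.tendsto_δ
  filter_upwards [eventually_ge_atTop 1, h.tendsto_δ.eventually_ge_atTop 0] with t ht hδ
  exact le_mul_of_one_le_left hδ (Real.one_le_rpow ht h.q_nonneg)

theorem eventually_mul_rpow_sub_one_lt (h : IsDampedTrajectory g δ α β a p q x v) (c : ℝ)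
    (hε : 0 < ε) : ∀ᶠ t : ℝ in atTop, c * t ^ (q - 1) < ε := by
  have hlim := (tendsto_rpow_atTop_nhds_zero (sub_neg.2 h.q_lt_one)).const_mul c
  rw [mul_zero] at hlim
  exact hlim.eventually_lt_const hε

theorem inner_gradient_ge_gap (h : IsDampedTrajectory g δ α β a p q x v) (z : X) (t : ℝ) :
    g (x t) - g z ≤ inner ℝ (gradient g (x t)) (x t - z) := by
  have hgrad := inner_gradient_le_sub_of_convexOn h.convexOn (h.differentiable (x t)) z
  rw [← neg_sub (x t) z, inner_neg_right] at hgrad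
  linarith

theorem eventually_le_energy (h : IsDampedTrajectory g δ α β a p q x v) (hz : z ∈ argmin g)
    (hb : 0 < b) (hbα : b < α) :
    ∀ᶠ t in atTop, 1 / 2 * (t ^ (2 * q) * δ t * (g (x t) - g z))
      + b * (α - b) / 4 * ‖x t - z‖ ^ 2 ≤ energy g δ α β a p q b z x v t := by
  filter_upwards [eventually_gt_atTop 0,
    h.tendsto_rpow_mul_δ.eventually_ge_atTop (2 * ((α - b) * β)),
    h.eventually_mul_rpow_sub_one_lt q (half_pos (sub_pos.2 hbα))] with t ht hδ hq
  exact le_energy h.a_nonneg hb.le ht hz hδ hq.le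

theorem eventually_gap_le_energy (h : IsDampedTrajectory g δ α β a p q x v) (hz : z ∈ argmin g)
    (hb : 0 < b) (hbα : b < α) :
    ∀ᶠ t in atTop, 1 / 2 * (t ^ (2 * q) * δ t * (g (x t) - g z)) ≤
      energy g δ α β a p q b z x v t := by
  have hcoeff : 0 ≤ b * (α - b) / 4 :=
    div_nonneg (mul_nonneg hb.le (sub_nonneg.2 hbα.le)) zero_le_four
  filter_upwards [h.eventually_le_energy hz hb hbα] with t hle
  exact (le_add_of_nonneg_right (mul_nonneg hcoeff (sq_nonneg _))).trans hle

theorem eventually_dist_sq_le_energy (h : IsDampedTrajectory g δ α β a p q x v)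
    (hz : z ∈ argmin g) (hb : 0 < b) (hbα : b < α) :
    ∀ᶠ t in atTop, ‖x t - z‖ ^ 2 ≤
      4 / (b * (α - b)) * energy g δ α β a p q b z x v t := by
  filter_upwards [h.eventually_le_energy hz hb hbα, eventually_gt_atTop 0,
    h.tendsto_δ.eventually_ge_atTop 0] with t hle ht hδ
  have hgap : 0 ≤ g (x t) - g z := sub_nonneg.2 (hz _)
  have hpos : 0 < b * (α - b) := mul_pos hb (sub_pos.2 hbα)
  rw [div_mul_eq_mul_div, le_div_iff₀ hpos]
  have hpotential : 0 ≤ 1 / 2 * (t ^ (2 * q) * δ t * (g (x t) - g z)) := by positivity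
  linarith

theorem eventually_energy_nonneg (h : IsDampedTrajectory g δ α β a p q x v) (hz : z ∈ argmin g)
    (hb : 0 < b) (hbα : b < α) : ∀ᶠ t in atTop, 0 ≤ energy g δ α β a p q b z x v t := by
  filter_upwards [h.eventually_gap_le_energy hz hb hbα, eventually_gt_atTop 0,
    h.tendsto_δ.eventually_ge_atTop 0] with t hle ht hδ
  have hgap : 0 ≤ g (x t) - g z := sub_nonneg.2 (hz _)
  exact le_trans (by positivity) hle

theorem eventually_deriv_weight_le (h : IsDampedTrajectory g δ α β a p q x v) (hε : 0 < ε) :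
    ∀ᶠ t in atTop, 2 * q * t ^ (2 * q - 1) * δ t + t ^ (2 * q) * deriv δ t ≤
      ε * (t ^ q * δ t) := by
  obtain ⟨K, hK⟩ := h.growth
  filter_upwards [hK, h.eventually_mul_rpow_sub_one_lt (2 * q + K) hε, eventually_gt_atTop 0,
    h.tendsto_δ.eventually_ge_atTop 0] with t hgrowth hsmall ht hδ
  have hI : t ^ (2 * q - 1) = t ^ q * t ^ (q - 1) := by
    rw [← Real.rpow_add ht]
    ring_nf
  have hQ : t ^ (2 * q) = t ^ (2 * q - 1) * t := by
    rw [Real.rpow_sub_one ht.ne', div_mul_cancel₀ _ ht.ne']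
  calc 2 * q * t ^ (2 * q - 1) * δ t + t ^ (2 * q) * deriv δ t
      = t ^ q * t ^ (q - 1) * (2 * q * δ t + t * deriv δ t) := by
        rw [hQ, hI]
        ring
    _ ≤ t ^ q * t ^ (q - 1) * (2 * q * δ t + K * δ t) := by gcongr
    _ = (2 * q + K) * t ^ (q - 1) * (t ^ q * δ t) := by ring
    _ ≤ ε * (t ^ q * δ t) := by gcongr

theorem neg_mul_inner_gradient_le (h : IsDampedTrajectory g δ α β a p q x v)
    (hz : z ∈ argmin g) (ht : 1 ≤ t) :
    -(a * β * t ^ (2 * q - p) * inner ℝ (gradient g (x t)) (x t)) ≤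
      β / 2 * (t ^ q) ^ 2 * ‖gradient g (x t)‖ ^ 2 + β * a ^ 2 * ‖z‖ ^ 2 / 2 * t ^ (q - p) := by
  have hpos : 0 < t := zero_lt_one.trans_le ht
  have hβ := h.β_nonneg
  have hmonotone : 0 ≤ inner ℝ (gradient g (x t)) (x t - z) :=
    (sub_nonneg.2 (hz _)).trans (h.inner_gradient_ge_gap z t)
  set u := gradient g (x t)
  have hP₀ : 0 ≤ t ^ (q - p) := Real.rpow_nonneg hpos.le _
  have hP₁ : t ^ (q - p) ≤ 1 :=
    Real.rpow_le_one_of_one_le_of_nonpos ht (by linarith [h.q_add_one_lt])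
  have hyoung := neg_mul_inner_le_of_inner_sub_nonneg (Real.rpow_nonneg hpos.le q)
    (mul_nonneg h.a_nonneg hP₀) hmonotone
  calc -(a * β * t ^ (2 * q - p) * inner ℝ u (x t))
      = β / 2 * -(2 * (t ^ q * (a * t ^ (q - p))) * inner ℝ u (x t)) := by
        rw [show 2 * q - p = q + (q - p) by ring, Real.rpow_add hpos]
        ring
    _ ≤ β / 2 * ((t ^ q) ^ 2 * ‖u‖ ^ 2 + (a * t ^ (q - p)) ^ 2 * ‖z‖ ^ 2) := by gcongr
    _ = β / 2 * (t ^ q) ^ 2 * ‖u‖ ^ 2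
          + β * a ^ 2 * ‖z‖ ^ 2 / 2 * (t ^ (q - p) * t ^ (q - p)) := by ring
    _ ≤ β / 2 * (t ^ q) ^ 2 * ‖u‖ ^ 2 + β * a ^ 2 * ‖z‖ ^ 2 / 2 * t ^ (q - p) := by
        gcongr
        exact mul_le_of_le_one_left hP₀ hP₁

theorem eventually_deriv_tikhonovEnergy_le (h : IsDampedTrajectory g δ α β a p q x v)
    (hz : z ∈ argmin g) (hε : 0 < ε) :
    ∀ᶠ t in atTop, deriv (tikhonovEnergy g δ α β a p q z x v) t ≤
      ε * (t ^ q * δ t) * (g (x t) - g z) - t ^ q * (α - q * t ^ (q - 1)) * ‖v t‖ ^ 2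
        + β * a ^ 2 * ‖z‖ ^ 2 / 2 * t ^ (q - p) := by
  filter_upwards [h.solution, h.differentiableAt_δ, eventually_ge_atTop 1,
    h.eventually_deriv_weight_le hε, h.tendsto_rpow_mul_δ.eventually_ge_atTop (2 * (α * β)),
    h.tendsto_δ.eventually_ge_atTop 1] with t hsol hδ ht hweight hQδ hδ₁
  have hpos : 0 < t := zero_lt_one.trans_le ht
  have hα := h.α_pos
  have hβ := h.β_nonneg
  have ha := h.a_nonneg
  have hq := h.q_nonneg
  have hgap : 0 ≤ g (x t) - g z := sub_nonneg.2 (hz _)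
  rw [(hsol.hasDerivAt_tikhonovEnergy hpos (h.differentiable _) hδ z).deriv]
  set u := gradient g (x t)
  have hQ : 0 ≤ t ^ q := Real.rpow_nonneg hpos.le q
  have hpotential : (2 * q * t ^ (2 * q - 1) * δ t + t ^ (2 * q) * deriv δ t
      - α * β * (q * t ^ (q - 1))) * (g (x t) - g z) ≤
        ε * (t ^ q * δ t) * (g (x t) - g z) := by
    refine mul_le_mul_of_nonneg_right ((sub_le_self _ ?_).trans hweight) hgap
    positivity
  have hgradient : β / 2 * (t ^ q) ^ 2 * ‖u‖ ^ 2 ≤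
      β * t ^ q * (t ^ q * δ t - α * β) * ‖u‖ ^ 2 := by
    have hQ_le : t ^ q / 2 ≤ t ^ q * δ t - α * β := by
      linarith [le_mul_of_one_le_right hQ hδ₁]
    calc β / 2 * (t ^ q) ^ 2 * ‖u‖ ^ 2 = β * t ^ q * (t ^ q / 2) * ‖u‖ ^ 2 := by ring
      _ ≤ β * t ^ q * (t ^ q * δ t - α * β) * ‖u‖ ^ 2 := by gcongr
  have htikhonov : 0 ≤ a / 2 * (p - 2 * q) * t ^ (2 * q - p - 1) * ‖x t‖ ^ 2 := by
    have hpq : 0 ≤ p - 2 * q := by linarith [h.q_add_one_lt, h.q_lt_one]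
    positivity
  have hcross := h.neg_mul_inner_gradient_le hz ht
  linarith

theorem eventually_deriv_anchor_le (h : IsDampedTrajectory g δ α β a p q x v)
    (hz : z ∈ argmin g) :
    ∀ᶠ t in atTop, deriv (anchor g α β q z x v) t ≤
      -(1 / 2 * (t ^ q * δ t) * (g (x t) - g z)) + t ^ q * ‖v t‖ ^ 2
        + a * ‖z‖ ^ 2 / 2 * t ^ (q - p)
        + q * (1 - q) / 2 * t ^ (q - 2) * ‖x t - z‖ ^ 2 := by
  filter_upwards [h.solution, eventually_ge_atTop 1,
    h.eventually_mul_rpow_sub_one_lt (2 * (β * q)) one_half_pos,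
    h.tendsto_rpow_mul_δ.eventually_ge_atTop 1] with t hsol ht hI hQδ
  have hpos : 0 < t := zero_lt_one.trans_le ht
  have hgap : 0 ≤ g (x t) - g z := sub_nonneg.2 (hz _)
  rw [(hsol.hasDerivAt_anchor hpos (h.differentiable _) z).deriv]
  have hgradient : 0 ≤ β ^ 2 * t ^ q * ‖gradient g (x t)‖ ^ 2 := by positivity
  have hconvex : (t ^ q * δ t - β * (q * t ^ (q - 1))) * (g (x t) - g z) ≤
      (t ^ q * δ t - β * (q * t ^ (q - 1))) * inner ℝ (gradient g (x t)) (x t - z) :=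
    mul_le_mul_of_nonneg_left (h.inner_gradient_ge_gap z t) (by linarith)
  have hpotential : 1 / 2 * (t ^ q * δ t) * (g (x t) - g z) ≤
      (t ^ q * δ t - 2 * (β * (q * t ^ (q - 1)))) * (g (x t) - g z) :=
    mul_le_mul_of_nonneg_right (by linarith) hgap
  have htikhonov : a * t ^ (q - p) * -inner ℝ (x t - z) (x t) ≤
      a * t ^ (q - p) * (‖z‖ ^ 2 / 2) :=
    mul_le_mul_of_nonneg_left (neg_inner_sub_le_norm_sq _ _)
      (mul_nonneg h.a_nonneg (Real.rpow_nonneg hpos.le _))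
  linarith

theorem eventually_hasDerivAt_energy (h : IsDampedTrajectory g δ α β a p q x v) (b : ℝ) (z : X) :
    ∀ᶠ t in atTop, HasDerivAt (energy g δ α β a p q b z x v)
      (deriv (tikhonovEnergy g δ α β a p q z x v) t + b * deriv (anchor g α β q z x v) t) t := by
  filter_upwards [h.solution, h.differentiableAt_δ, eventually_gt_atTop 0] with t hsol hδ ht
  have htikhonov := hsol.hasDerivAt_tikhonovEnergy ht (h.differentiable _) hδ z
  have hanchor := hsol.hasDerivAt_anchor ht (h.differentiable _) z
  rw [htikhonov.deriv, hanchor.deriv]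
  exact htikhonov.add (hanchor.const_mul b)

theorem eventually_deriv_energy_le (h : IsDampedTrajectory g δ α β a p q x v)
    (hz : z ∈ argmin g) (hb : 0 < b) (hbα : b < α) :
    ∀ᶠ t in atTop, deriv (energy g δ α β a p q b z x v) t ≤
      -(b / 4 * (t ^ q * δ t * (g (x t) - g z)) + (α - b) / 2 * (t ^ q * ‖v t‖ ^ 2))
        + ((β * a ^ 2 + b * a) * ‖z‖ ^ 2 / 2 * t ^ (q - p)
          + b * (q * (1 - q) / 2) * t ^ (q - 2) * ‖x t - z‖ ^ 2) := by
  have hαb : 0 < α - b := sub_pos.2 hbα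
  filter_upwards [h.eventually_hasDerivAt_energy b z,
    h.eventually_deriv_tikhonovEnergy_le hz (by positivity : 0 < b / 4),
    h.eventually_deriv_anchor_le hz, h.eventually_mul_rpow_sub_one_lt q (half_pos hαb),
    eventually_gt_atTop 0] with t hderiv htikhonov hanchor hI ht
  have hfriction : (α - b) / 2 * (t ^ q * ‖v t‖ ^ 2) ≤
      (α - b - q * t ^ (q - 1)) * (t ^ q * ‖v t‖ ^ 2) :=
    mul_le_mul_of_nonneg_right (by linarith) (by positivity)
  have hanchor_b := mul_le_mul_of_nonneg_left hanchor hb.le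
  rw [hderiv.deriv]
  linarith

theorem exists_deriv_energy_le (h : IsDampedTrajectory g δ α β a p q x v) (hz : z ∈ argmin g)
    (hb : 0 < b) (hbα : b < α) :
    ∃ κ : ℝ, 0 < κ ∧ ∃ C s : ℝ, s < -1 ∧
      ∀ᶠ t in atTop, deriv (energy g δ α β a p q b z x v) t ≤
        -(κ * (t ^ (2 * q) * mechanicalEnergy g δ z x v t) * t ^ (-q))
          + C * t ^ s * (1 + energy g δ α β a p q b z x v t) := by
  have hαb : 0 < α - b := sub_pos.2 hbα
  have ha := h.a_nonneg
  have hβ := h.β_nonneg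
  have hq := h.q_nonneg
  have hq₁ : 0 ≤ 1 - q := sub_nonneg.2 h.q_lt_one.le
  set κ := min (b / 4) (α - b)
  set C₁ := (β * a ^ 2 + b * a) * ‖z‖ ^ 2 / 2
  set C₂ := b * (q * (1 - q) / 2) * (4 / (b * (α - b)))
  refine ⟨κ, lt_min (by positivity) hαb, max C₁ C₂, max (q - p) (q - 2),
    max_lt (by linarith [h.q_add_one_lt]) (by linarith [h.q_lt_one]), ?_⟩
  filter_upwards [h.eventually_deriv_energy_le hz hb hbα,
    h.eventually_dist_sq_le_energy hz hb hbα, h.eventually_energy_nonneg hz hb hbα,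
    eventually_ge_atTop 1, h.tendsto_δ.eventually_ge_atTop 0] with t hderiv hdist hE ht hδ
  have hpos : 0 < t := zero_lt_one.trans_le ht
  have hgap : 0 ≤ g (x t) - g z := sub_nonneg.2 (hz _)
  set 𝓔 := energy g δ α β a p q b z x v t
  have hdissipation : κ * (t ^ (2 * q) * mechanicalEnergy g δ z x v t) * t ^ (-q) ≤
      b / 4 * (t ^ q * δ t * (g (x t) - g z)) + (α - b) / 2 * (t ^ q * ‖v t‖ ^ 2) := by
    calc κ * (t ^ (2 * q) * mechanicalEnergy g δ z x v t) * t ^ (-q)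
        = κ * (t ^ q * δ t * (g (x t) - g z)) + κ / 2 * (t ^ q * ‖v t‖ ^ 2) := by
          rw [mul_assoc, rpow_mul_mechanicalEnergy_mul_rpow_neg hpos]
          ring
      _ ≤ _ := by gcongr; exacts [min_le_left _ _, min_le_right _ _]
  have herror : C₁ * t ^ (q - p) + b * (q * (1 - q) / 2) * t ^ (q - 2) * ‖x t - z‖ ^ 2 ≤
      max C₁ C₂ * t ^ max (q - p) (q - 2) * (1 + 𝓔) := by
    calc C₁ * t ^ (q - p) + b * (q * (1 - q) / 2) * t ^ (q - 2) * ‖x t - z‖ ^ 2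
        ≤ C₁ * t ^ (q - p) + b * (q * (1 - q) / 2) * t ^ (q - 2)
            * (4 / (b * (α - b)) * 𝓔) := by gcongr
      _ = C₁ * t ^ (q - p) * 1 + C₂ * t ^ (q - 2) * 𝓔 := by ring
      _ ≤ max C₁ C₂ * t ^ max (q - p) (q - 2) * 1
            + max C₁ C₂ * t ^ max (q - p) (q - 2) * 𝓔 := by
          gcongr
          exacts [le_max_left _ _, le_max_left _ _, le_max_right _ _, le_max_right _ _]
      _ = _ := by ring
  exact hderiv.trans (add_le_add (neg_le_neg hdissipation) herror)

theorem exists_tendsto_energy (h : IsDampedTrajectory g δ α β a p q x v) (hz : z ∈ argmin g)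
    (hb : 0 < b) (hbα : b < α) : ∃ L, Tendsto (energy g δ α β a p q b z x v) atTop (𝓝 L) := by
  obtain ⟨κ, hκ, C, s, hs, hderiv⟩ := h.exists_deriv_energy_le hz hb hbα
  refine exists_tendsto_of_deriv_le_rpow_mul_one_add (C := C) hs
    ((h.eventually_hasDerivAt_energy b z).mono fun t ht => ht.differentiableAt) ?_
    (h.eventually_energy_nonneg hz hb hbα)
  filter_upwards [hderiv, eventually_gt_atTop 0, h.tendsto_δ.eventually_ge_atTop 0]
    with t hle ht hδ
  have hmechanical : 0 ≤ mechanicalEnergy g δ z x v t := mechanicalEnergy_nonneg hδ hz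
  exact hle.trans (add_le_of_nonpos_left (neg_nonpos.2 (by positivity)))

theorem exists_tendsto_tikhonovEnergy_and_anchor (h : IsDampedTrajectory g δ α β a p q x v)
    (hz : z ∈ argmin g) :
    (∃ L, Tendsto (tikhonovEnergy g δ α β a p q z x v) atTop (𝓝 L)) ∧
      ∃ L, Tendsto (anchor g α β q z x v) atTop (𝓝 L) := by
  have hα := h.α_pos
  obtain ⟨L₁, hL₁⟩ := h.exists_tendsto_energy hz (b := α / 3) (by linarith) (by linarith)
  obtain ⟨L₂, hL₂⟩ := h.exists_tendsto_energy hz (b := 2 * α / 3) (by linarith) (by linarith)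
  refine ⟨⟨_, ((hL₁.const_mul 2).sub hL₂).congr fun t => ?_⟩,
    ⟨_, ((hL₂.sub hL₁).const_mul (3 / α)).congr fun t => ?_⟩⟩
  · simp only [energy]
    ring
  · simp only [energy]
    field_simp
    ring

theorem isBigO_sub_one (h : IsDampedTrajectory g δ α β a p q x v) (hz : z ∈ argmin g) (y : X) :
    (fun t => x t - y) =O[atTop] fun _ => (1 : ℝ) := by
  have hα := h.α_pos
  obtain ⟨L, hL⟩ := h.exists_tendsto_energy hz (half_pos hα) (half_lt_self hα)
  set c := 4 / (α / 2 * (α - α / 2))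
  have hsq : (fun t => ‖x t - z‖ ^ 2) =O[atTop] fun _ => (1 : ℝ) ^ 2 := by
    rw [one_pow]
    refine IsBigO.trans (.of_norm_eventuallyLE ?_) ((hL.const_mul c).isBigO_one ℝ)
    filter_upwards [h.eventually_dist_sq_le_energy hz (half_pos hα) (half_lt_self hα)] with t ht
    rwa [Real.norm_of_nonneg (sq_nonneg _)]
  have hdist : (fun t => x t - z) =O[atTop] fun _ => (1 : ℝ) :=
    (IsBigO.of_pow two_ne_zero hsq).of_norm_left
  simpa only [sub_add_sub_cancel] using hdist.add (isBigO_const_const (z - y) one_ne_zero atTop)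

theorem tendsto_rpow_mul_norm_sub_sq (h : IsDampedTrajectory g δ α β a p q x v)
    (hz : z ∈ argmin g) {r : ℝ} (hr : r < 0) (y : X) :
    Tendsto (fun t => t ^ r * ‖x t - y‖ ^ 2) atTop (𝓝 0) := by
  refine ((isBigO_refl (fun t : ℝ => t ^ r) atTop).mul
    ((h.isBigO_sub_one hz y).norm_left.pow 2)).trans_tendsto ?_
  simpa only [one_pow, mul_one] using tendsto_rpow_atTop_nhds_zero hr

theorem tendsto_rpow_mul_gap (h : IsDampedTrajectory g δ α β a p q x v) (hz : z ∈ argmin g) :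
    Tendsto (fun t => t ^ q * (g (x t) - g z)) atTop (𝓝 0) := by
  have hα := h.α_pos
  obtain ⟨L, hL⟩ := h.exists_tendsto_energy hz (half_pos hα) (half_lt_self hα)
  have hbound := h.tendsto_rpow_mul_δ.inv_tendsto_atTop.mul (hL.const_mul 2)
  rw [zero_mul] at hbound
  refine squeeze_zero' ?_ ?_ hbound
  · filter_upwards [eventually_gt_atTop 0] with t ht
    exact mul_nonneg (Real.rpow_nonneg ht.le _) (sub_nonneg.2 (hz _))
  · filter_upwards [h.eventually_gap_le_energy hz (half_pos hα) (half_lt_self hα),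
      eventually_gt_atTop 0, h.tendsto_rpow_mul_δ.eventually_gt_atTop 0] with t hle ht hQδ
    rw [Pi.inv_apply, inv_mul_eq_div, le_div_iff₀ hQδ]
    rw [rpow_two_mul ht] at hle
    linarith

theorem tendsto_gap (h : IsDampedTrajectory g δ α β a p q x v) (hz : z ∈ argmin g) :
    Tendsto (fun t => g (x t)) atTop (𝓝 (g z)) := by
  refine tendsto_sub_nhds_zero_iff.1 (squeeze_zero' (.of_forall fun t => sub_nonneg.2 (hz _)) ?_
    (h.tendsto_rpow_mul_gap hz))
  filter_upwards [eventually_ge_atTop 1] with t ht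
  exact le_mul_of_one_le_left (sub_nonneg.2 (hz _)) (Real.one_le_rpow ht h.q_nonneg)

theorem exists_tendsto_rpow_mul_mechanicalEnergy (h : IsDampedTrajectory g δ α β a p q x v)
    (hz : z ∈ argmin g) :
    ∃ L, Tendsto (fun t => t ^ (2 * q) * mechanicalEnergy g δ z x v t) atTop (𝓝 L) := by
  obtain ⟨L, hL⟩ := (h.exists_tendsto_tikhonovEnergy_and_anchor hz).1
  have hpq : 2 * q - p < 0 := by linarith [h.q_add_one_lt, h.q_lt_one]
  refine ⟨_, ((hL.add ((h.tendsto_rpow_mul_gap hz).const_mul (α * β))).sub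
    ((h.tendsto_rpow_mul_norm_sub_sq hz hpq 0).const_mul (a / 2))).congr fun t => ?_⟩
  simp only [tikhonovEnergy, sub_zero]
  ring

theorem tendsto_rpow_mul_mechanicalEnergy (h : IsDampedTrajectory g δ α β a p q x v)
    (hz : z ∈ argmin g) :
    Tendsto (fun t => t ^ (2 * q) * mechanicalEnergy g δ z x v t) atTop (𝓝 0) := by
  have hb := half_pos h.α_pos
  have hbα := half_lt_self h.α_pos
  obtain ⟨L, hL⟩ := h.exists_tendsto_rpow_mul_mechanicalEnergy hz
  obtain ⟨ℓ, hℓ⟩ := h.exists_tendsto_energy hz hb hbα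
  obtain ⟨κ, hκ, C, s, hs, hderiv⟩ := h.exists_deriv_energy_le hz hb hbα
  have hL_nonpos : L ≤ 0 := limit_nonpos_of_deriv_le hκ h.q_lt_one hs
    ((h.eventually_hasDerivAt_energy _ z).mono fun t ht => ht.differentiableAt) hderiv hℓ hL
  have hL_nonneg : 0 ≤ L := by
    refine ge_of_tendsto hL ?_
    filter_upwards [eventually_gt_atTop 0, h.tendsto_δ.eventually_ge_atTop 0] with t ht hδ
    exact mul_nonneg (Real.rpow_nonneg ht.le _) (mechanicalEnergy_nonneg hδ hz)
  rwa [le_antisymm hL_nonpos hL_nonneg] at hL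

theorem tendsto_δ_mul_rpow_mul_gap (h : IsDampedTrajectory g δ α β a p q x v)
    (hz : z ∈ argmin g) :
    Tendsto (fun t => δ t * t ^ (2 * q) * (g (x t) - g z)) atTop (𝓝 0) := by
  refine squeeze_zero' ?_ ?_ (h.tendsto_rpow_mul_mechanicalEnergy hz)
  all_goals
    filter_upwards [eventually_gt_atTop 0, h.tendsto_δ.eventually_ge_atTop 0] with t ht hδ
    have hgap : 0 ≤ g (x t) - g z := sub_nonneg.2 (hz _)
  · positivity
  · have hkinetic : 0 ≤ t ^ (2 * q) * (1 / 2 * ‖v t‖ ^ 2) := by positivity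
    rw [mechanicalEnergy]
    linarith

theorem tendsto_rpow_mul_norm (h : IsDampedTrajectory g δ α β a p q x v)
    (hz : z ∈ argmin g) : Tendsto (fun t => t ^ q * ‖v t‖) atTop (𝓝 0) := by
  have hbound := ((h.tendsto_rpow_mul_mechanicalEnergy hz).const_mul 2).sqrt
  rw [mul_zero, Real.sqrt_zero] at hbound
  refine squeeze_zero' ?_ ?_ hbound
  all_goals
    filter_upwards [eventually_gt_atTop 0, h.tendsto_δ.eventually_ge_atTop 0] with t ht hδ
  · positivity
  · have hgap : 0 ≤ g (x t) - g z := sub_nonneg.2 (hz _)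
    have hpotential : 0 ≤ (t ^ q) ^ 2 * (δ t * (g (x t) - g z)) := by positivity
    refine Real.le_sqrt_of_sq_le ?_
    rw [rpow_two_mul ht, mechanicalEnergy]
    linarith

theorem exists_tendsto_norm_sub (h : IsDampedTrajectory g δ α β a p q x v) (hz : z ∈ argmin g) :
    ∃ r, Tendsto (fun t => ‖x t - z‖) atTop (𝓝 r) := by
  obtain ⟨L, hL⟩ := (h.exists_tendsto_tikhonovEnergy_and_anchor hz).2
  have hpairing : Tendsto (fun t => t ^ q * inner ℝ (x t - z) (v t)) atTop (𝓝 0) := by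
    have hproduct : (fun t => t ^ q * inner ℝ (x t - z) (v t)) =O[atTop]
        fun t => t ^ q * (1 * ‖v t‖) :=
      (isBigO_refl _ _).mul ((IsBigO.of_norm_le fun t => norm_inner_le_norm _ _).trans
        ((h.isBigO_sub_one hz z).norm_left.mul (isBigO_refl _ _)))
    refine hproduct.trans_tendsto ?_
    simpa only [one_mul] using h.tendsto_rpow_mul_norm hz
  have hcorrection := h.tendsto_rpow_mul_norm_sub_sq hz (sub_neg.2 h.q_lt_one) z
  refine ⟨_, ((((hL.sub ((h.tendsto_rpow_mul_gap hz).const_mul β)).sub hpairing).add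
    (hcorrection.const_mul (q / 2))).const_mul (2 / α)).sqrt.congr fun t => ?_⟩
  have hα := h.α_pos
  refine (congrArg Real.sqrt ?_).trans (Real.sqrt_sq (norm_nonneg (x t - z)))
  simp only [anchor]
  field_simp
  ring

theorem exists_tendsto_toWeakSpace (h : IsDampedTrajectory g δ α β a p q x v)
    (hg : (argmin g).Nonempty) :
    ∃ z ∈ argmin g, Tendsto (fun t => toWeakSpace ℝ X (x t)) atTop (𝓝 (toWeakSpace ℝ X z)) := by
  refine exists_tendsto_toWeakSpace_of_opial hg (fun z hz => h.exists_tendsto_norm_sub hz) ?_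
  obtain ⟨z, hz⟩ := hg
  exact fun w hw y => (le_of_mapClusterPt_toWeakSpace h.convexOn
    h.differentiable.continuous.lowerSemicontinuous (h.tendsto_gap hz) hw).trans (hz y)

end IsDampedTrajectory

end Dissipation

section StrongGlobalSolution

variable {X : Type*} [NormedAddCommGroup X] [InnerProductSpace ℝ X] [CompleteSpace X]
  {g : X → ℝ} {δ : ℝ → ℝ} {α β a p q t t₀ : ℝ} {x : ℝ → X}

theorem IsStrongGlobalSolution.isFirstOrderSolutionAt
    (hx : IsStrongGlobalSolution g δ α β a p q t₀ x) (ht₀ : 0 < t₀)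
    (hδ : ContinuousOn δ (Ici t₀)) (ht : t₀ < t) :
    IsFirstOrderSolutionAt g δ α β a p q x
      (timeDeriv t₀ x + fun s => β • gradient g (x s)) t := by
  set F : ℝ → X := fun s =>
    -((α / s ^ q) • timeDeriv t₀ x s) - δ s • gradient g (x s) - (a / s ^ p) • x s with hF
  have hx' : ∀ s, t₀ < s → HasDerivAt x (timeDeriv t₀ x s) s := fun s hs =>
    hasDerivAt_timeDeriv (hx.differentiable s hs.le) hs
  have hx_cont : ContinuousOn x (Ici t₀) := hx.differentiable.continuousOn
  have hgrad_cont : ContinuousOn (fun s => gradient g (x s)) (Ici t₀) := fun s hs =>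
    (hx.hessian_exists s hs).continuousAt.comp_continuousWithinAt (hx_cont s hs)
  have hF_cont : ContinuousOn F (Ici t₀) :=
    (((continuousOn_div_rpow ht₀ α q).smul hx.velocity_ac.continuousOn).neg.sub
      (hδ.smul hgrad_cont)).sub ((continuousOn_div_rpow ht₀ a p).smul hx_cont)
  have hgrad' : ∀ s, t₀ < s → HasDerivAt (fun s => β • gradient g (x s))
      (β • fderiv ℝ (gradient g) (x s) (timeDeriv t₀ x s)) s := fun s hs =>
    ((hx.hessian_exists s hs.le).hasFDerivAt.comp_hasDerivAt s (hx' s hs)).const_smul β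
  have hsum : ∀ᵐ s, t₀ < s →
      HasDerivAt (timeDeriv t₀ x + fun s => β • gradient g (x s)) (F s) s := by
    filter_upwards [(ae_restrict_iff' measurableSet_Ici).1 hx.equation] with s hs hmem
    obtain ⟨hdiff, heq⟩ := hs hmem.le
    refine ((hasDerivAt_timeDeriv hdiff hmem).add (hgrad' s hmem)).congr_deriv ?_
    rw [← sub_eq_zero, ← heq, hF]
    module
  have hmomentum : HasDerivAt (timeDeriv t₀ x + fun s => β • gradient g (x s)) (F t) t :=
    hx.velocity_ac.hasDerivAt_add (hgrad_cont.const_smul β)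
      (fun s hs => (hgrad' s hs).differentiableAt) hF_cont hsum ht
  have hvelocity : (timeDeriv t₀ x + fun s => β • gradient g (x s)) t - β • gradient g (x t) =
      timeDeriv t₀ x t := add_sub_cancel_right _ _
  exact ⟨hvelocity ▸ hx' t ht, by rwa [hvelocity]⟩

theorem IsStrongGlobalSolution.isDampedTrajectory
    (hx : IsStrongGlobalSolution g δ α β a p q t₀ x) (hg_conv : ConvexOn ℝ univ g)
    (hg_diff : Differentiable ℝ g) (hα : 0 < α) (hβ : 0 ≤ β) (ha : 0 ≤ a) (ht₀ : 0 < t₀)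
    (hq₀ : 0 ≤ q) (hq₁ : q < 1) (hp : q + 1 < p) (hδ_diff : DifferentiableOn ℝ δ (Ici t₀))
    (hδ_lim : Tendsto δ atTop atTop)
    (hδ_growth : ∃ K, ∀ᶠ t in atTop, t * timeDeriv t₀ δ t ≤ K * δ t) :
    IsDampedTrajectory g δ α β a p q x (timeDeriv t₀ x + fun t => β • gradient g (x t)) := by
  have hδ' : ∀ᶠ t in atTop, HasDerivAt δ (timeDeriv t₀ δ t) t := by
    filter_upwards [eventually_gt_atTop t₀] with t ht
    exact hasDerivAt_timeDeriv (hδ_diff t ht.le) ht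
  refine ⟨hg_conv, hg_diff, hα, hβ, ha, hq₀, hq₁, hp, hδ_lim,
    hδ'.mono fun t ht => ht.differentiableAt, ?_, ?_⟩
  · obtain ⟨K, hK⟩ := hδ_growth
    exact ⟨K, hK.mp (hδ'.mono fun t ht hle => by rwa [ht.deriv])⟩
  · filter_upwards [eventually_gt_atTop t₀] with t ht
    exact hx.isFirstOrderSolutionAt ht₀ hδ_diff.continuousOn ht

end StrongGlobalSolution

theorem theorem3p3_general {X : Type*} [NormedAddCommGroup X] [InnerProductSpace ℝ X]
    [CompleteSpace X] (g : X → ℝ) (hg_conv : ConvexOn ℝ univ g) (hg_diff : Differentiable ℝ g)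
    (hg_min : (argmin g).Nonempty)
    (α β a p q t₀ : ℝ) (hα : 0 < α) (hβ : 0 ≤ β) (ha : 0 ≤ a) (ht₀ : 0 < t₀)
    (hq₀ : 0 ≤ q) (hq₁ : q < 1) (hp : q + 1 < p)
    (δ : ℝ → ℝ) (hδ_diff : DifferentiableOn ℝ δ (Ici t₀)) (hδ_lim : Tendsto δ atTop atTop)
    (hδ_growth : ∃ K : ℝ, ∀ᶠ t in atTop, t * timeDeriv t₀ δ t ≤ K * δ t)
    (x : ℝ → X) (hx : IsStrongGlobalSolution g δ α β a p q t₀ x) :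
    (∃ z ∈ argmin g,
      Tendsto (fun t => toWeakSpace ℝ X (x t)) atTop (𝓝 (toWeakSpace ℝ X z))) ∧
    ∀ z ∈ argmin g,
      (fun t => g (x t) - g z) =o[atTop] (fun t => 1 / (δ t * t ^ (2 * q))) ∧
      (fun t => ‖timeDeriv t₀ x t + β • gradient g (x t)‖) =o[atTop] (fun t => 1 / t ^ q) := by
  have h := hx.isDampedTrajectory hg_conv hg_diff hα hβ ha ht₀ hq₀ hq₁ hp hδ_diff hδ_lim hδ_growth
  have hpow : ∀ r : ℝ, ∀ᶠ t : ℝ in atTop, t ^ r ≠ 0 := fun r =>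
    (eventually_gt_atTop 0).mono fun t ht => (Real.rpow_pos_of_pos ht r).ne'
  refine ⟨h.exists_tendsto_toWeakSpace hg_min, fun z hz => ⟨?_, ?_⟩⟩
  · refine isLittleO_one_div_of_tendsto_mul ?_ (h.tendsto_δ_mul_rpow_mul_gap hz)
    filter_upwards [hδ_lim.eventually_ne_atTop 0, hpow (2 * q)] with t hδ ht
    exact mul_ne_zero hδ ht
  · exact isLittleO_one_div_of_tendsto_mul (hpow q) (h.tendsto_rpow_mul_norm hz)

theorem theorem3p3 {X : Type*} [NormedAddCommGroup X] [InnerProductSpace ℝ X] [CompleteSpace X]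
    (g : X → ℝ) (hg_conv : ConvexOn ℝ univ g) (hg_diff : Differentiable ℝ g)
    (hg_min : (argmin g).Nonempty)
    (α β a p q t₀ : ℝ) (hα : 0 < α) (hβ : 0 < β) (ha : 0 < a) (ht₀ : 0 < t₀)
    (hq₀ : 0 < q) (hq₁ : q < 1) (hp : q + 1 < p) (hp₂ : p ≤ 2)
    (ha₂ : p = 2 → q * (1 - q) ≤ a)
    (δ : ℝ → ℝ) (hδ_pos : ∀ t, t₀ ≤ t → 0 < δ t) (hδ_mono : MonotoneOn δ (Ici t₀))
    (hδ_diff : DifferentiableOn ℝ δ (Ici t₀)) (hδ_lim : Tendsto δ atTop atTop)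
    (hδ_growth : ∃ K₁ : ℝ, 0 < K₁ ∧ ∀ᶠ t in atTop, t * timeDeriv t₀ δ t < K₁ * δ t)
    (x : ℝ → X) (hx : IsStrongGlobalSolution g δ α β a p q t₀ x) :
    (∃ z ∈ argmin g,
      Tendsto (fun t => toWeakSpace ℝ X (x t)) atTop (𝓝 (toWeakSpace ℝ X z))) ∧
    ∀ z ∈ argmin g,
      (fun t => g (x t) - g z) =o[atTop] (fun t => 1 / (δ t * t ^ (2 * q))) ∧
      (fun t => ‖timeDeriv t₀ x t + β • gradient g (x t)‖) =o[atTop] (fun t => 1 / t ^ q) :=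
  theorem3p3_general g hg_conv hg_diff hg_min α β a p q t₀ hα hβ.le ha.le ht₀ hq₀.le hq₁ hp δ
    hδ_diff hδ_lim (hδ_growth.imp fun _ hK => hK.2.mono fun _ ht => ht.le) x hx
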